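/- Let $M$ be a $C^\infty$ manifold of dimension $n\ge 3$. A Finsler metric on $M$ is a function $F=F(x,y)\ge 0$ on $TM$, $C^\infty$ on $TM\setminus\{0\}$, with $F(x,y)=0$ if and only if $y=0$, with $F(x,\lambda y)=\lambda F(x,y)$ for $\lambda\ge 0$, and such that in local coordinates the matrix $g_{ij}=\tfrac12[F^2]_{y^iy^j}$ is positive definite for $y\ne 0$. Write $(g^{ij})=(g_{ij})^{-1}$ and, with summation over repeated indices, $$G^i=\tfrac14 g^{il}\Big\{\frac{\partial^2[F^2]}{\partial x^m\partial y^l}y^m-\frac{\partial [F^2]}{\partial x^l}\Big\},\qquad R^i_{\ k}=2\frac{\partial G^i}{\partial x^k}-\frac{\partial^2G^i}{\partial x^l\partial y^k}y^l+2G^l\frac{\partial^2G^i}{\partial y^l\partial y^k}-\frac{\partial G^i}{\partial y^l}\frac{\partial G^l}{\partial y^k}.$$ $F$ is said to be of scalar flag curvature $\mathbf K=\mathbf K(x,y)$ if for every $y\in T_xM\setminus\{0\}$ and every $u\in T_xM$ linearly independent of $y$, $$\frac{g_{im}R^i_{\ k}u^ku^m}{F^2g_{ij}u^iu^j-[g_{ij}y^iu^j]^2}=\mathbf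 K(x,y).$$ For functions $T=T(x,y)$ write $T_{\cdot k}=\partial T/\partial y^k$, and let "${}_|$" denote the covariant derivative of the Berwald connection: $T_{|m}=\frac{\partial T}{\partial x^m}-G^l_{\cdot m}T_{\cdot l}$ and $T_{\cdot k|m}=\frac{\partial T_{\cdot k}}{\partial x^m}-G^l_{\cdot m}T_{\cdot k\cdot l}-G^l_{\cdot k\cdot m}T_{\cdot l}$. The index $0$ denotes contraction with $y$: $T_{|0}=T_{|m}y^m$, $T_{\cdot k|0}=T_{\cdot k|m}y^m$. **Lemma.** Let $F$ be a Finsler metric on $M$, $\dim M=n\ge 3$, of scalar flag curvature $\mathbf K=\mathbf K(x,y)$. Then in any local coordinates, for all $y\neq 0$ and all $k$, $$F\,\mathbf K_{|k}-F_{\cdot k}\,\mathbf K_{|0}-\tfrac13F\,\mathbf K_{\cdot k|0}=0,$$ equivalently, $$\Big[\frac{\mathbf K_{|0}}{F}\Big]_{\cdot k}=\frac43\,\frac{\mathbf K_{\cdot k|0}}{F}.$$ -/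

import Mathlib

open scoped Manifold ContDiff Matrix

noncomputable section

/-! Finsler geometry: local coordinate expressions on (an open part of) `ℝⁿ × ℝⁿ`,
Finsler metrics on manifolds, scalar flag curvature, Berwald covariant derivatives.

A function `T : E n → E n → ℝ` is read as `T(x, y)`, with position `x` and direction `y`. -/
namespace Finsler

/-- The coordinate space `ℝⁿ`. -/
abbrev E (n : ℕ) : Type := EuclideanSpace ℝ (Fin n)

section Coordinates

variable {n : ℕ}

/-- The partial derivative `∂T/∂x^k`. -/
def dx (k : Fin n) (T : E n → E n → ℝ) : E n → E n → ℝ := fun x y =>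
  fderiv ℝ (fun x' => T x' y) x (EuclideanSpace.single k 1)

/-- The partial derivative `T_{·k} = ∂T/∂y^k`. -/
def dy (k : Fin n) (T : E n → E n → ℝ) : E n → E n → ℝ := fun x y =>
  fderiv ℝ (fun y' => T x y') y (EuclideanSpace.single k 1)

/-- The fundamental tensor `g_{ij} = ½ [F²]_{y^i y^j}`. -/
def fundTensor (F : E n → E n → ℝ) (x y : E n) : Matrix (Fin n) (Fin n) ℝ :=
  Matrix.of fun i j => (1 / 2) * dy j (dy i (fun x y => F x y ^ 2)) x y

/-- The geodesic coefficients
`G^i = ¼ g^{il} { ∂²[F²]/∂x^m∂y^l · y^m - ∂[F²]/∂x^l }`. -/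
def geodesicCoeff (F : E n → E n → ℝ) (i : Fin n) : E n → E n → ℝ := fun x y =>
  (1 / 4) * ∑ l, (fundTensor F x y)⁻¹ i l *
    ((∑ m, dx m (dy l (fun x y => F x y ^ 2)) x y * y m) - dx l (fun x y => F x y ^ 2) x y)

/-- The Riemann curvature
`R^i_k = 2 ∂G^i/∂x^k - ∂²G^i/∂x^l∂y^k · y^l + 2 G^l ∂²G^i/∂y^l∂y^k - ∂G^i/∂y^l · ∂G^l/∂y^k`. -/
def riemannCurvature (F : E n → E n → ℝ) (i k : Fin n) : E n → E n → ℝ := fun x y =>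
  2 * dx k (geodesicCoeff F i) x y
    - ∑ l, dx l (dy k (geodesicCoeff F i)) x y * y l
    + 2 * ∑ l, geodesicCoeff F l x y * dy l (dy k (geodesicCoeff F i)) x y
    - ∑ l, dy l (geodesicCoeff F i) x y * dy k (geodesicCoeff F l) x y

/-- The flag curvature of the flag `span {y, u}` with flag pole `y`:
`g_{im} R^i_k u^k u^m / (F² g_{ij} u^i u^j - (g_{ij} y^i u^j)²)`. -/
def flagCurvature (F : E n → E n → ℝ) (x y u : E n) : ℝ :=
  (∑ i, ∑ m, ∑ k, fundTensor F x y i m * riemannCurvature F i k x y * u k * u m) /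
    (F x y ^ 2 * (∑ i, ∑ j, fundTensor F x y i j * u i * u j)
      - (∑ i, ∑ j, fundTensor F x y i j * y i * u j) ^ 2)

/-- The Berwald horizontal derivative of a scalar function:
`T_{|m} = ∂T/∂x^m - G^l_{·m} T_{·l}`. -/
def hderiv (F : E n → E n → ℝ) (m : Fin n) (T : E n → E n → ℝ) : E n → E n → ℝ := fun x y =>
  dx m T x y - ∑ l, dy m (geodesicCoeff F l) x y * dy l T x y

/-- The contraction `T_{|0} = T_{|m} y^m` for a scalar function. -/
def hderivZero (F : E n → E n → ℝ) (T : E n → E n → ℝ) : E n → E n → ℝ := fun x y =>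
  ∑ m, hderiv F m T x y * y m

/-- The Berwald covariant derivative of a covector field `θ = θ_k(x, y) dx^k`:
`θ_{k|m} = ∂θ_k/∂x^m - G^l_{·m} θ_{k·l} - G^l_{·k·m} θ_l`. -/
def hderivCovector (F : E n → E n → ℝ) (m : Fin n) (θ : Fin n → E n → E n → ℝ) (k : Fin n) :
    E n → E n → ℝ := fun x y =>
  hderiv F m (θ k) x y - ∑ l, dy m (dy k (geodesicCoeff F l)) x y * θ l x y

/-- The contraction `θ_{k|0} = θ_{k|m} y^m` for a covector field. -/
def hderivCovectorZero (F : E n → E n → ℝ) (θ : Fin n → E n → E n → ℝ) (k : Fin n) :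
    E n → E n → ℝ := fun x y =>
  ∑ m, hderivCovector F m θ k x y * y m

end Coordinates

section Manifold

variable {n : ℕ} {M : Type*} [TopologicalSpace M] [ChartedSpace (E n) M]

/-- The expression `T(x, y)` of a function `T` on `TM` in the coordinates `(x^i, y^i)` of `TM`
induced by a chart `e` of `M`: the vector with coordinates `(x, y)` is `y^i ∂/∂x^i` at the point
with coordinates `x`, that is, the image of `(x, y)` under the differential of the inverse
chart. It is meaningful for `x ∈ e.target`. -/
def inChart (e : OpenPartialHomeomorph M (E n)) (T : TangentBundle (𝓡 n) M → ℝ) :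
    E n → E n → ℝ := fun x y =>
  T (tangentMap (𝓡 n) (𝓡 n) e.symm ⟨x, y⟩)

/-- `F` is a Finsler metric on the smooth `n`-dimensional manifold `M`. -/
structure IsFinslerMetric [IsManifold (𝓡 n) ∞ M] (F : TangentBundle (𝓡 n) M → ℝ) : Prop where
  /-- `F` is smooth on `TM \ {0}`. -/
  smooth : ContMDiffOn (𝓡 n).tangent 𝓘(ℝ, ℝ) ∞ F {v | v.2 ≠ 0}
  nonneg : ∀ v, 0 ≤ F v
  eq_zero_iff : ∀ v, F v = 0 ↔ v.2 = 0
  /-- Positive homogeneity of degree one. -/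
  homogeneous : ∀ (p : M) (y : TangentSpace (𝓡 n) p) (c : ℝ), 0 ≤ c → F ⟨p, c • y⟩ = c * F ⟨p, y⟩
  /-- Strong convexity: in local coordinates, `(g_{ij}(x, y))` is positive definite for `y ≠ 0`. -/
  posDef : ∀ e ∈ IsManifold.maximalAtlas (𝓡 n) ∞ M, ∀ x ∈ e.target, ∀ y : E n, y ≠ 0 →
    (fundTensor (inChart e F) x y).PosDef

/-- `F` is of scalar flag curvature `K = K(x, y)`: in local coordinates, for each flag pole
`y ≠ 0` and each tangent plane `span {y, u}` containing it, the flag curvature is `K(x, y)`. -/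
def IsOfScalarFlagCurvature [IsManifold (𝓡 n) ∞ M] (F K : TangentBundle (𝓡 n) M → ℝ) : Prop :=
  ∀ e ∈ IsManifold.maximalAtlas (𝓡 n) ∞ M, ∀ x ∈ e.target, ∀ y u : E n,
    LinearIndependent ℝ ![y, u] →
      flagCurvature (inChart e F) x y u = inChart e K x y

end Manifold

end Finsler

end

noncomputable section

namespace Finsler

/-! The identity is a traced Bianchi identity. Write $N^i_k=G^i_{\cdot k}$ and
$\delta_m=\partial_{x^m}-N^l_m\partial_{y^l}$. The curvature $R^i_{kl}$ of the connection $N$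
measures the failure of the $\delta_m$ to commute. It is tied to the Riemann curvature by
$R^i_{kl}y^l=R^i_k$ and $R^i_{k\cdot l}-R^i_{l\cdot k}=3R^i_{kl}$ (`sum_curv_mul_y`,
`Y_riem_antisymm`), and `curv_bianchi` becomes `trace_bianchi` after contraction with $y$ and a
trace.

Scalar flag curvature means $R^i_k=\kappa(F^2\delta^i_k-FF_{\cdot k}y^i)$, by self-adjointness of
$R$ and polarisation (`curvature_eq_of_flag`). Substituting this, with $F_{|m}=0$, into the traced
identity leaves $(n-2)F$ times the claim (`scalar_curvature_eq`); hence $n\ge 3$. The second form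
follows from $(\kappa_{|0})_{\cdot k}=\kappa_{|k}+\kappa_{\cdot k|0}$ (`Y_sprayDer`).

All of this needs only commuting derivations, so it is done in an abstract algebra `PhaseAlgebra`,
then applied to smooth functions on the slit tangent bundle over a chart. -/

lemma derivation_sum_apply {ι A : Type*} [CommRing A] [Algebra ℝ A] (s : Finset ι)
    (D : ι → Derivation ℝ A A) (a : A) : (∑ l ∈ s, D l) a = ∑ l ∈ s, D l a := by
  induction s using Finset.cons_induction with
  | empty => simp
  | cons i s hi ih => rw [Finset.sum_cons, Finset.sum_cons, Derivation.add_apply, ih]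

/-- An algebraic model of the smooth functions of `(x, y)`: an algebra with commuting derivations
`X i = ∂/∂x^i`, `Y i = ∂/∂y^i` and the coordinate functions `y i`. -/
structure PhaseAlgebra (ι A : Type*) [DecidableEq ι] [CommRing A] [Algebra ℝ A] where
  X : ι → Derivation ℝ A A
  Y : ι → Derivation ℝ A A
  y : ι → A
  X_X : ∀ i j a, X i (X j a) = X j (X i a)
  X_Y : ∀ i j a, X i (Y j a) = Y j (X i a)
  Y_Y : ∀ i j a, Y i (Y j a) = Y j (Y i a)
  X_y : ∀ i j, X i (y j) = 0
  Y_y : ∀ i j, Y i (y j) = if i = j then 1 else 0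

/-! ### Calculus of sprays: connection, curvature, Bianchi identity. -/

namespace PhaseAlgebra

variable {ι A : Type*} [Fintype ι] [DecidableEq ι] [CommRing A] [Algebra ℝ A]
  (P : PhaseAlgebra ι A) (G : ι → A)

/-- The horizontal derivation `∂/∂x^m - G^l_{·m} ∂/∂y^l`. -/
def hor (m : ι) : Derivation ℝ A A := P.X m - ∑ l, P.Y m (G l) • P.Y l

/-- The Euler (Liouville) derivation `y^l ∂/∂y^l`. -/
def euler : Derivation ℝ A A := ∑ l, P.y l • P.Y l

/-- The spray derivation `y^m δ_m`. -/
def sprayDer : Derivation ℝ A A := ∑ m, P.y m • P.hor G m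

/-- The curvature of the nonlinear connection `G^i_{·k}`. -/
def curv (i k l : ι) : A := P.hor G k (P.Y l (G i)) - P.hor G l (P.Y k (G i))

/-- The Riemann curvature of the spray with coefficients `G`. -/
def riem (i k : ι) : A :=
  2 * P.X k (G i) - ∑ l, P.X l (P.Y k (G i)) * P.y l + 2 * ∑ l, G l * P.Y l (P.Y k (G i))
    - ∑ l, P.Y l (G i) * P.Y k (G l)

lemma hor_apply (m : ι) (a : A) :
    P.hor G m a = P.X m a - ∑ l, P.Y m (G l) * P.Y l a := by
  simp [hor, derivation_sum_apply]

lemma euler_apply (a : A) : P.euler a = ∑ l, P.y l * P.Y l a := by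
  simp [euler, derivation_sum_apply]

lemma sprayDer_apply (a : A) : P.sprayDer G a = ∑ m, P.y m * P.hor G m a := by
  simp [sprayDer, derivation_sum_apply]

lemma hor_y (m i : ι) : P.hor G m (P.y i) = - P.Y m (G i) := by
  simp [hor_apply, P.X_y, P.Y_y]

lemma euler_y (i : ι) : P.euler (P.y i) = P.y i := by
  simp [euler_apply, P.Y_y]

lemma euler_Y (k : ι) (a : A) : P.euler (P.Y k a) = P.Y k (P.euler a) - P.Y k a := by
  simp only [euler_apply, map_sum, Derivation.leibniz, P.Y_y, smul_eq_mul, mul_ite, mul_one,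
    mul_zero, Finset.sum_add_distrib, Finset.sum_ite_eq, Finset.mem_univ, if_true]
  simp only [P.Y_Y k]
  ring

lemma euler_X (k : ι) (a : A) : P.euler (P.X k a) = P.X k (P.euler a) := by
  simp only [euler_apply, map_sum, Derivation.leibniz, P.X_y, smul_eq_mul, mul_zero, add_zero,
    P.X_Y]

lemma Y_hor (k m : ι) (a : A) :
    P.Y k (P.hor G m a) = P.hor G m (P.Y k a) - ∑ s, P.Y k (P.Y m (G s)) * P.Y s a := by
  simp only [hor_apply, map_sub, map_sum, Derivation.leibniz, smul_eq_mul, P.X_Y,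
    Finset.sum_add_distrib, P.Y_Y k]
  simp only [mul_comm]
  ring

lemma hor_commutator (k l : ι) (a : A) :
    P.hor G k (P.hor G l a) - P.hor G l (P.hor G k a) = - ∑ s, P.curv G s k l * P.Y s a := by
  -- The parenthesis collects the second-order terms. It is symmetric in $k,l$, so only the first
  -- sum survives in the commutator.
  have key : ∀ k l, P.hor G k (P.hor G l a) = - ∑ s, P.hor G k (P.Y l (G s)) * P.Y s a
      + (P.X k (P.X l a) - ∑ s, P.Y k (G s) * P.Y s (P.X l a)
        - ∑ s, P.Y l (G s) * P.Y s (P.X k a)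
        + ∑ s, ∑ t, P.Y l (G s) * (P.Y k (G t) * P.Y t (P.Y s a))) := by
    intro k l
    rw [P.hor_apply G l a, map_sub, map_sum]
    simp only [Derivation.leibniz, smul_eq_mul, Finset.sum_add_distrib]
    rw [P.hor_apply G k (P.X l a)]
    have : ∀ s, P.hor G k (P.Y s a) = P.Y s (P.X k a) - ∑ t, P.Y k (G t) * P.Y t (P.Y s a) :=
      fun s => by rw [hor_apply, P.X_Y]
    simp only [this, mul_sub, Finset.sum_sub_distrib, Finset.mul_sum, mul_comm (P.Y _ a)]
    ring
  have symm : ∑ s, ∑ t, P.Y l (G s) * (P.Y k (G t) * P.Y t (P.Y s a))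
      = ∑ s, ∑ t, P.Y k (G s) * (P.Y l (G t) * P.Y t (P.Y s a)) := by
    rw [Finset.sum_comm]
    refine Finset.sum_congr rfl fun s _ => Finset.sum_congr rfl fun t _ => ?_
    rw [P.Y_Y s t]; ring
  rw [key k l, key l k, symm, P.X_X k l]
  simp only [curv, sub_mul, Finset.sum_sub_distrib]
  ring

lemma curv_antisymm (i k l : ι) : P.curv G i k l = - P.curv G i l k := by
  simp [curv]

/-- The commutator formula is applied to $G^i_{\cdot m}$ and summed cyclically; the second
horizontal derivatives regroup into derivatives of `curv`. -/
lemma curv_bianchi (i k l m : ι) :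
    P.hor G m (P.curv G i k l) + P.hor G k (P.curv G i l m) + P.hor G l (P.curv G i m k)
      + ∑ s, P.curv G s k l * P.Y s (P.Y m (G i)) + ∑ s, P.curv G s l m * P.Y s (P.Y k (G i))
      + ∑ s, P.curv G s m k * P.Y s (P.Y l (G i)) = 0 := by
  have h1 := P.hor_commutator G k l (P.Y m (G i))
  have h2 := P.hor_commutator G l m (P.Y k (G i))
  have h3 := P.hor_commutator G m k (P.Y l (G i))
  have e : ∀ k l m, P.hor G m (P.curv G i k l)
      = P.hor G m (P.hor G k (P.Y l (G i))) - P.hor G m (P.hor G l (P.Y k (G i))) :=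
    fun k l m => by rw [curv, map_sub]
  rw [e, e, e]
  linear_combination h1 + h2 + h3

/-- Third-order terms and $G^i_{\cdot l}G^l_{\cdot k\cdot m}$ are symmetric in $k,m$ and drop out.
The others occur with coefficients $2$ and $-1$, whence the $3$, the source of the $\tfrac13$ in the
theorem. -/
lemma Y_riem_antisymm (i k m : ι) :
    P.Y m (P.riem G i k) - P.Y k (P.riem G i m) = 3 * P.curv G i k m := by
  have two : ∀ (j : ι) (a : A), P.Y j (2 * a) = 2 * P.Y j a := fun j a => by
    rw [two_mul, map_add, two_mul]
  have key : ∀ k m, P.Y m (P.riem G i k) = 2 * P.X k (P.Y m (G i)) - P.X m (P.Y k (G i))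
      - ∑ l, P.y l * P.X l (P.Y m (P.Y k (G i)))
      + 2 * ∑ l, G l * P.Y l (P.Y m (P.Y k (G i))) + 2 * ∑ l, P.Y m (G l) * P.Y l (P.Y k (G i))
      - ∑ l, P.Y k (G l) * P.Y l (P.Y m (G i)) - ∑ l, P.Y l (G i) * P.Y m (P.Y k (G l)) := by
    intro k m
    simp only [riem, map_sub, map_add, two, map_sum, Derivation.leibniz, smul_eq_mul,
      P.Y_y, mul_ite, mul_one, mul_zero, Finset.sum_add_distrib, Finset.sum_ite_eq,
      Finset.mem_univ, if_true, P.X_Y, P.Y_Y m]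
    simp only [mul_comm (P.Y _ (P.Y _ _))]
    ring
  rw [key k m, key m k]
  simp only [curv, hor_apply, P.Y_Y m k]
  ring

section Spray

variable (hG : ∀ i, P.euler (G i) = 2 * G i)
include hG

lemma sum_Y_mul_y (i : ι) : ∑ l, P.Y l (G i) * P.y l = 2 * G i := by
  rw [← hG, euler_apply]; simp only [mul_comm]

lemma sum_Y_Y_mul_y (i k : ι) : ∑ l, P.Y l (P.Y k (G i)) * P.y l = P.Y k (G i) := by
  have := P.euler_Y k (G i)
  rw [hG, euler_apply, two_mul, map_add] at this
  simp only [mul_comm _ (P.y _), this]; ring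

lemma sum_curv_mul_y (i k : ι) : ∑ m, P.curv G i k m * P.y m = P.riem G i k := by
  -- This is the $\delta_k$-derivative of $G^i_{\cdot m}y^m=2G^i$, with $\delta_k y^m=-G^m_{\cdot
  -- k}$.
  have h1 : ∑ m, P.hor G k (P.Y m (G i)) * P.y m
      = 2 * P.X k (G i) - ∑ l, P.Y l (G i) * P.Y k (G l) := by
    have := congrArg (P.hor G k) (P.sum_Y_mul_y G hG i)
    rw [map_sum] at this
    simp only [Derivation.leibniz, smul_eq_mul, hor_y, Finset.sum_add_distrib, two_mul, map_add,
      mul_neg, Finset.sum_neg_distrib] at this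
    simp only [mul_comm _ (P.y _)]
    rw [P.hor_apply G k (G i)] at this
    simp only [mul_comm (P.Y _ (G i))] at this ⊢
    linear_combination this
  have h2 : ∑ m, P.hor G m (P.Y k (G i)) * P.y m
      = ∑ l, P.X l (P.Y k (G i)) * P.y l - 2 * ∑ l, G l * P.Y l (P.Y k (G i)) := by
    simp only [hor_apply, sub_mul, Finset.sum_sub_distrib, Finset.sum_mul, Finset.mul_sum]
    rw [Finset.sum_comm]
    congr 1
    refine Finset.sum_congr rfl fun l _ => ?_
    rw [← mul_assoc, ← P.sum_Y_mul_y G hG l, Finset.sum_mul]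
    exact Finset.sum_congr rfl fun m _ => by ring
  simp only [curv, sub_mul, Finset.sum_sub_distrib, h1, h2, riem]
  ring

lemma sum_curv_mul_y' (i k : ι) : ∑ m, P.curv G i m k * P.y m = - P.riem G i k := by
  rw [← P.sum_curv_mul_y G hG, ← Finset.sum_neg_distrib]
  exact Finset.sum_congr rfl fun m _ => by rw [P.curv_antisymm G i m k]; ring

lemma euler_hor (m : ι) (a : A) : P.euler (P.hor G m a) = P.hor G m (P.euler a) := by
  have h : ∀ l, P.euler (P.Y m (G l)) = P.Y m (G l) := fun l => by
    rw [euler_Y, hG, two_mul, map_add]; ring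
  simp only [hor_apply, map_sub, map_sum, Derivation.leibniz, smul_eq_mul, h, euler_X, euler_Y]
  congr 1
  exact Finset.sum_congr rfl fun s _ => by ring

lemma euler_curv (i k l : ι) : P.euler (P.curv G i k l) = P.curv G i k l := by
  have h : ∀ m, P.euler (P.Y m (G i)) = P.Y m (G i) := fun m => by
    rw [euler_Y, hG, two_mul, map_add]; ring
  simp only [curv, map_sub, P.euler_hor G hG, h]

lemma euler_riem (i k : ι) : P.euler (P.riem G i k) = 2 * P.riem G i k := by
  rw [← P.sum_curv_mul_y G hG, map_sum, Finset.mul_sum]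
  refine Finset.sum_congr rfl fun m _ => ?_
  rw [Derivation.leibniz, P.euler_y, P.euler_curv G hG, smul_eq_mul, smul_eq_mul]
  ring

/-- The Bianchi identity, traced and contracted with `y`. -/
lemma trace_bianchi (l : ι) :
    P.sprayDer G (∑ k, P.curv G k k l) - ∑ m, (∑ k, P.curv G k k m) * P.Y l (G m)
      + ∑ k, P.hor G k (P.riem G k l) + ∑ s, P.riem G s l * ∑ k, P.Y s (P.Y k (G k))
      - P.hor G l (∑ k, P.riem G k k) - ∑ k, ∑ s, P.riem G s k * P.Y s (P.Y l (G k)) = 0 := by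
  have h1 : ∀ i k l, ∑ m, P.y m * P.hor G k (P.curv G i l m)
      = P.hor G k (P.riem G i l) + ∑ m, P.curv G i l m * P.Y k (G m) := by
    intro i k l
    rw [← P.sum_curv_mul_y G hG i l, map_sum]
    simp only [Derivation.leibniz, smul_eq_mul, hor_y, Finset.sum_add_distrib, mul_neg,
      Finset.sum_neg_distrib]
    ring
  have h2 : ∀ i k l, ∑ m, P.y m * P.hor G l (P.curv G i m k)
      = - P.hor G l (P.riem G i k) - ∑ m, P.curv G i k m * P.Y l (G m) := by
    intro i k l
    have := h1 i l k
    simp only [P.curv_antisymm G i _ k, map_neg, mul_neg, Finset.sum_neg_distrib, this]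
    ring
  -- The Bianchi identity contracted with $y^m$, before the trace over $i=k$.
  have key : ∀ i k, P.sprayDer G (P.curv G i k l)
      + (P.hor G k (P.riem G i l) + ∑ m, P.curv G i l m * P.Y k (G m))
      + (- P.hor G l (P.riem G i k) - ∑ m, P.curv G i k m * P.Y l (G m))
      + ∑ s, P.curv G s k l * P.Y s (G i)
      + ∑ s, P.riem G s l * P.Y s (P.Y k (G i)) - ∑ s, P.riem G s k * P.Y s (P.Y l (G i)) = 0 := by
    intro i k
    have e1 : ∑ m, P.y m * ∑ s, P.curv G s k l * P.Y s (P.Y m (G i))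
        = ∑ s, P.curv G s k l * P.Y s (G i) := by
      simp only [Finset.mul_sum]
      rw [Finset.sum_comm]
      refine Finset.sum_congr rfl fun s _ => ?_
      rw [← P.sum_Y_Y_mul_y G hG i s, Finset.mul_sum]
      exact Finset.sum_congr rfl fun m _ => by rw [P.Y_Y s m]; ring
    have e2 : ∑ m, P.y m * ∑ s, P.curv G s l m * P.Y s (P.Y k (G i))
        = ∑ s, P.riem G s l * P.Y s (P.Y k (G i)) := by
      simp only [Finset.mul_sum]
      rw [Finset.sum_comm]
      refine Finset.sum_congr rfl fun s _ => ?_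
      rw [← P.sum_curv_mul_y G hG s l, Finset.sum_mul]
      exact Finset.sum_congr rfl fun m _ => by ring
    have e3 : ∑ m, P.y m * ∑ s, P.curv G s m k * P.Y s (P.Y l (G i))
        = - ∑ s, P.riem G s k * P.Y s (P.Y l (G i)) := by
      simp only [Finset.mul_sum]
      rw [Finset.sum_comm, ← Finset.sum_neg_distrib]
      refine Finset.sum_congr rfl fun s _ => ?_
      rw [← neg_mul, ← P.sum_curv_mul_y' G hG s k, Finset.sum_mul]
      exact Finset.sum_congr rfl fun m _ => by ring
    have b : ∑ m, P.y m * (P.hor G m (P.curv G i k l) + P.hor G k (P.curv G i l m)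
        + P.hor G l (P.curv G i m k)
        + ∑ s, P.curv G s k l * P.Y s (P.Y m (G i)) + ∑ s, P.curv G s l m * P.Y s (P.Y k (G i))
        + ∑ s, P.curv G s m k * P.Y s (P.Y l (G i))) = 0 :=
      Finset.sum_eq_zero fun m _ => by rw [curv_bianchi, mul_zero]
    simp only [mul_add, Finset.sum_add_distrib] at b
    rw [h1, h2, e1, e2, e3, ← sprayDer_apply] at b
    linear_combination b
  have tr := Finset.sum_eq_zero fun k (_ : k ∈ Finset.univ) => key k k
  simp only [Finset.sum_add_distrib, Finset.sum_sub_distrib, Finset.sum_neg_distrib] at tr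
  -- After the trace, two of the connection terms cancel by antisymmetry of `curv`.
  have c1 : ∑ k, ∑ m, P.curv G k l m * P.Y k (G m) = - ∑ k, ∑ s, P.curv G s k l * P.Y s (G k) := by
    rw [Finset.sum_comm, ← Finset.sum_neg_distrib]
    refine Finset.sum_congr rfl fun k _ => ?_
    rw [← Finset.sum_neg_distrib]
    exact Finset.sum_congr rfl fun s _ => by rw [P.curv_antisymm G s l k]; ring
  have c2 : ∑ m, (∑ k, P.curv G k k m) * P.Y l (G m) = ∑ k, ∑ m, P.curv G k k m * P.Y l (G m) := by
    rw [Finset.sum_comm]; simp only [Finset.sum_mul]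
  have c3 : ∑ s, P.riem G s l * ∑ k, P.Y s (P.Y k (G k))
      = ∑ k, ∑ s, P.riem G s l * P.Y s (P.Y k (G k)) := by
    rw [Finset.sum_comm]; simp only [Finset.mul_sum]
  rw [map_sum, map_sum, c2, c3]
  linear_combination tr - c1

end Spray

end PhaseAlgebra

namespace PhaseAlgebra

variable {ι A : Type*} [Fintype ι] [DecidableEq ι] [CommRing A] [Algebra ℝ A]
  (P : PhaseAlgebra ι A) (G : ι → A) (hG : ∀ i, P.euler (G i) = 2 * G i)
include hG

lemma sum_y_mul_berwald (k : ι) (a : A) :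
    ∑ m, P.y m * ∑ l, P.Y m (P.Y k (G l)) * P.Y l a = ∑ m, P.Y m a * P.Y k (G m) := by
  simp only [Finset.mul_sum]
  rw [Finset.sum_comm]
  refine Finset.sum_congr rfl fun s _ => ?_
  conv_rhs => rw [← P.sum_Y_Y_mul_y G hG s k, Finset.mul_sum]
  exact Finset.sum_congr rfl fun m _ => by ring

/-- The parenthesis is $a_{\cdot k|0}$: since $G^l_{\cdot k}$ has degree one in $y$, contracting
$G^l_{\cdot k\cdot m}$ with $y^m$ gives back $G^l_{\cdot k}$. -/
lemma Y_sprayDer (k : ι) (a : A) : P.Y k (P.sprayDer G a)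
    = P.hor G k a + (P.sprayDer G (P.Y k a) - ∑ m, P.Y m a * P.Y k (G m)) := by
  simp only [← P.sum_y_mul_berwald G hG, sprayDer_apply, map_sum, Derivation.leibniz, smul_eq_mul,
    P.Y_y, Y_hor, mul_ite, mul_one, mul_zero, Finset.sum_add_distrib, Finset.sum_ite_eq,
    Finset.mem_univ, if_true, mul_sub, Finset.sum_sub_distrib, P.Y_Y k]
  ring

end PhaseAlgebra

/-- An algebra of functions may have zero divisors, so cancellation goes through units such as $2$,
$n-1$, $n-2$ and $F$. -/
lemma isUnit_natCast_sub {A : Type*} [CommRing A] [Algebra ℝ A] {m n : ℕ} (h : m ≠ n) :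
    IsUnit ((n : A) - (m : A)) := by
  have h0 : ((n : ℝ) - m) ≠ 0 := sub_ne_zero.2 (by exact_mod_cast h.symm)
  simpa using (IsUnit.mk0 _ h0).map (algebraMap ℝ A)

/-! ### Geodesic sprays and scalar curvature. -/

namespace PhaseAlgebra

variable {ι A : Type*} [Fintype ι] [DecidableEq ι] [CommRing A] [Algebra ℝ A]
  (P : PhaseAlgebra ι A) (G : ι → A)

/-- `G` are the geodesic coefficients of the Finsler metric `F`, with `L = F²`, and the
`y`-Hessian of `L` is nondegenerate. -/
structure IsGeodesicSpray (F : A) : Prop where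
  isUnit : IsUnit F
  euler_eq : P.euler F = F
  nondegenerate : ∀ v : ι → A, (∀ l, ∑ i, P.Y i (P.Y l (F ^ 2)) * v i = 0) → ∀ i, v i = 0
  spray_eq : ∀ l, 2 * ∑ i, P.Y i (P.Y l (F ^ 2)) * G i
    = ∑ m, P.X m (P.Y l (F ^ 2)) * P.y m - P.X l (F ^ 2)

namespace IsGeodesicSpray

variable {P G} {F : A} (h : P.IsGeodesicSpray G F)
include h

lemma euler_sq : P.euler (F ^ 2) = 2 * F ^ 2 := by
  rw [pow_two, Derivation.leibniz, h.euler_eq, smul_eq_mul]; ring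

lemma euler_Y_sq (l : ι) : P.euler (P.Y l (F ^ 2)) = P.Y l (F ^ 2) := by
  rw [euler_Y, h.euler_sq, two_mul, map_add]; ring

lemma euler_Y_Y_sq (i l : ι) : P.euler (P.Y i (P.Y l (F ^ 2))) = 0 := by
  rw [euler_Y, h.euler_Y_sq]; ring

/-- In the geodesic equation the Hessian has degree $0$ and the right side degree $2$, so the
Hessian kills $y^lG^i_{\cdot l}-2G^i$. -/
lemma euler_spray (i : ι) : P.euler (G i) = 2 * G i := by
  have u2 : IsUnit (2 : A) := by simpa using isUnit_natCast_sub (A := A) (m := 0) (n := 2) (by simp)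
  refine sub_eq_zero.1 (h.nondegenerate (fun i => P.euler (G i) - 2 * G i) (fun l => ?_) i)
  have e := congrArg P.euler (h.spray_eq l)
  rw [two_mul, map_add, map_sub, map_sum, map_sum] at e
  simp only [Derivation.leibniz, smul_eq_mul, h.euler_Y_Y_sq, mul_zero, add_zero, euler_X,
    h.euler_Y_sq, h.euler_sq, euler_y, Finset.sum_add_distrib, two_mul, map_add] at e
  have e' := h.spray_eq l
  simp only [mul_comm (P.y _)] at e
  simp only [mul_sub, Finset.sum_sub_distrib, mul_left_comm _ (2 : A)]
  rw [← Finset.mul_sum]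
  refine u2.mul_left_cancel ?_
  linear_combination e - 2 * e'

/-- Contracting the geodesic equation with $y^l$ gives `e1`. Its $y^k$-derivative minus the $k$-th
geodesic equation is twice the claim. -/
lemma hor_sq (k : ι) : P.hor G k (F ^ 2) = 0 := by
  have u2 : IsUnit (2 : A) := by simpa using isUnit_natCast_sub (A := A) (m := 0) (n := 2) (by simp)
  have e1 : 2 * ∑ i, P.Y i (F ^ 2) * G i = ∑ m, P.X m (F ^ 2) * P.y m := by
    have := Finset.sum_congr rfl fun l (_ : l ∈ Finset.univ) => congrArg (P.y l * ·) (h.spray_eq l)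
    simp only [mul_sub, Finset.sum_sub_distrib] at this
    have a1 : ∑ l, P.y l * (2 * ∑ i, P.Y i (P.Y l (F ^ 2)) * G i)
        = 2 * ∑ i, P.Y i (F ^ 2) * G i := by
      simp only [Finset.mul_sum]
      rw [Finset.sum_comm]
      refine Finset.sum_congr rfl fun i _ => ?_
      rw [← h.euler_Y_sq i, euler_apply, Finset.sum_mul, Finset.mul_sum]
      exact Finset.sum_congr rfl fun l _ => by rw [P.Y_Y i l]; ring
    have a2 : ∑ l, P.y l * ∑ m, P.X m (P.Y l (F ^ 2)) * P.y m
        = 2 * ∑ m, P.X m (F ^ 2) * P.y m := by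
      simp only [Finset.mul_sum]
      rw [Finset.sum_comm]
      refine Finset.sum_congr rfl fun m _ => ?_
      have : 2 * P.X m (F ^ 2) = P.euler (P.X m (F ^ 2)) := by
        rw [euler_X, h.euler_sq, two_mul, two_mul, map_add]
      rw [← mul_assoc, this, euler_apply, Finset.sum_mul]
      exact Finset.sum_congr rfl fun l _ => by rw [P.X_Y]; ring
    rw [a1, a2] at this
    simp only [mul_comm (P.y _)] at this
    linear_combination this
  have e2 := congrArg (P.Y k) e1
  rw [two_mul, map_add, map_sum, map_sum] at e2
  simp only [Derivation.leibniz, smul_eq_mul, P.Y_y, mul_ite, mul_one, mul_zero,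
    Finset.sum_add_distrib, Finset.sum_ite_eq, Finset.mem_univ, if_true] at e2
  have e3 := h.spray_eq k
  simp only [P.Y_Y k] at e2
  simp only [P.X_Y] at e3
  simp only [mul_comm (P.y _), mul_comm (G _)] at e2 e3
  rw [hor_apply]
  simp only [mul_comm _ (P.Y _ (F ^ 2))]
  refine u2.mul_left_cancel ?_
  linear_combination e3 - e2

lemma hor_eq_zero (k : ι) : P.hor G k F = 0 := by
  have u2 : IsUnit (2 : A) := by simpa using isUnit_natCast_sub (A := A) (m := 0) (n := 2) (by simp)
  have := h.hor_sq k
  rw [pow_two, Derivation.leibniz, smul_eq_mul] at this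
  refine (u2.mul h.isUnit).mul_left_cancel ?_
  linear_combination this

lemma sum_curv_mul_Y (k l : ι) : ∑ s, P.curv G s k l * P.Y s (F ^ 2) = 0 := by
  have := P.hor_commutator G k l (F ^ 2)
  simpa [h.hor_sq] using this.symm

lemma sum_riem_mul_Y (k : ι) : ∑ s, P.riem G s k * P.Y s (F ^ 2) = 0 := by
  simp only [← P.sum_curv_mul_y G h.euler_spray, Finset.sum_mul]
  rw [Finset.sum_comm]
  refine Finset.sum_eq_zero fun m _ => ?_
  rw [← mul_zero (P.y m), ← h.sum_curv_mul_Y k m, Finset.mul_sum]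
  exact Finset.sum_congr rfl fun l _ => by ring

/-- The Riemann curvature is self-adjoint with respect to the fundamental tensor. -/
lemma riem_symm (k m : ι) : ∑ i, P.Y m (P.Y i (F ^ 2)) * P.riem G i k
    = ∑ i, P.Y k (P.Y i (F ^ 2)) * P.riem G i m := by
  -- Differentiate $R^i_k[F^2]_{\cdot i}=0$ in $y^m$ and antisymmetrise: the terms without Hessian
  -- form $3R^i_{km}[F^2]_{\cdot i}=0$.
  have e1 := congrArg (P.Y m) (h.sum_riem_mul_Y k)
  have e2 := congrArg (P.Y k) (h.sum_riem_mul_Y m)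
  simp only [map_sum, Derivation.leibniz, smul_eq_mul, Finset.sum_add_distrib, map_zero] at e1 e2
  have e3 : ∑ i, P.Y i (F ^ 2) * P.Y m (P.riem G i k)
      - ∑ i, P.Y i (F ^ 2) * P.Y k (P.riem G i m) = 0 := by
    rw [← Finset.sum_sub_distrib, ← mul_zero 3, ← h.sum_curv_mul_Y k m, Finset.mul_sum]
    refine Finset.sum_congr rfl fun i _ => ?_
    rw [← mul_sub, Y_riem_antisymm]; ring
  simp only [mul_comm (P.Y _ (P.Y _ _))]
  linear_combination e1 - e2 - e3

lemma sum_riem_mul_y (i : ι) : ∑ k, P.riem G i k * P.y k = 0 := by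
  have u2 : IsUnit (2 : A) := by simpa using isUnit_natCast_sub (A := A) (m := 0) (n := 2) (by simp)
  have e : ∑ k, P.riem G i k * P.y k = - ∑ k, P.riem G i k * P.y k := by
    conv_lhs => simp only [← P.sum_curv_mul_y G h.euler_spray, Finset.sum_mul]
    rw [Finset.sum_comm, ← Finset.sum_neg_distrib]
    refine Finset.sum_congr rfl fun m _ => ?_
    rw [← neg_mul, ← P.sum_curv_mul_y' G h.euler_spray, Finset.sum_mul]
    exact Finset.sum_congr rfl fun l _ => by ring
  refine u2.mul_left_cancel ?_
  linear_combination e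

section Scalar

variable {κ : A} (hn : 3 ≤ Fintype.card ι)
  (hR : ∀ i k, P.riem G i k = κ * ((if i = k then F ^ 2 else 0) - F * P.Y k F * P.y i))
include hR

lemma trace_riem : ∑ k, P.riem G k k = ((Fintype.card ι : A) - 1) * (κ * F ^ 2) := by
  have e : ∑ k, P.y k * P.Y k F = F := by rw [← euler_apply, h.euler_eq]
  have e' : ∑ k, κ * (F * P.Y k F * P.y k) = κ * F ^ 2 := by
    conv_rhs => rw [pow_two]; enter [2, 2]; rw [← e]
    simp only [Finset.mul_sum]
    exact Finset.sum_congr rfl fun l _ => by ring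
  simp only [hR, if_true, mul_sub, Finset.sum_sub_distrib, e']
  simp
  ring

include hn

/-- In the trace $(n-1)\kappa F^2$ of the curvature, both the trace and $F^2$ have degree $2$. -/
lemma euler_scalar : P.euler κ = 0 := by
  have u1 : IsUnit ((Fintype.card ι : A) - 1) := by
    simpa using isUnit_natCast_sub (A := A) (m := 1) (n := Fintype.card ι) (by omega)
  have e := congrArg P.euler (h.trace_riem hR)
  rw [map_sum] at e
  simp only [P.euler_riem G h.euler_spray] at e
  rw [← Finset.mul_sum, h.trace_riem hR, Derivation.leibniz, Derivation.leibniz, h.euler_sq,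
    map_sub, Derivation.map_natCast, Derivation.map_one_eq_zero] at e
  simp only [smul_eq_mul] at e
  refine (u1.mul (h.isUnit.pow 2)).mul_left_cancel ?_
  linear_combination -e

/-- Trace of `Y_riem_antisymm`: $\kappa_{\cdot l}$ comes $n-1$ times from the trace of $R$ and $-1$
times from its divergence, which gives $n-2$. -/
lemma trace_curv (l : ι) : 3 * ∑ k, P.curv G k k l
    = ((Fintype.card ι : A) - 2) * (F ^ 2 * P.Y l κ)
      + 3 * ((Fintype.card ι : A) - 1) * (κ * F * P.Y l F) := by
  have eF : P.euler (P.Y l F) = 0 := by rw [euler_Y, h.euler_eq, sub_self]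
  have e1 : ∑ k, P.Y k (P.riem G k l) = P.Y l (κ * F ^ 2) - P.euler (κ * (F * P.Y l F))
      - Fintype.card ι * (κ * (F * P.Y l F)) := by
    have : ∀ k, P.riem G k l = (if k = l then κ * F ^ 2 else 0) - (κ * (F * P.Y l F)) * P.y k := by
      intro k; rw [hR]; split_ifs <;> ring
    simp only [this, map_sub, Finset.sum_sub_distrib, apply_ite (P.Y _), map_zero]
    rw [Finset.sum_ite_eq' Finset.univ l]
    simp only [Derivation.leibniz (P.Y _) _ (P.y _), smul_eq_mul, P.Y_y, if_true, mul_one,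
      Finset.sum_add_distrib, Finset.mem_univ]
    rw [← euler_apply]
    simp
    ring
  have e2 : P.euler (κ * (F * P.Y l F)) = κ * (F * P.Y l F) := by
    rw [Derivation.leibniz, Derivation.leibniz, h.euler_eq, eF, h.euler_scalar hn hR]
    simp
    ring
  have e3 : P.Y l (κ * F ^ 2) = F ^ 2 * P.Y l κ + 2 * κ * F * P.Y l F := by
    rw [pow_two, Derivation.leibniz, Derivation.leibniz]; simp only [smul_eq_mul]; ring
  have e4 : P.Y l (∑ k, P.riem G k k)
      = ((Fintype.card ι : A) - 1) * (F ^ 2 * P.Y l κ + 2 * κ * F * P.Y l F) := by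
    rw [h.trace_riem hR, Derivation.leibniz, e3, map_sub, Derivation.map_natCast,
      Derivation.map_one_eq_zero]
    simp
  rw [Finset.mul_sum]
  simp only [← Y_riem_antisymm, Finset.sum_sub_distrib]
  rw [← map_sum, e4, e1, e2, e3]
  ring

/-- The differential equation satisfied by the scalar flag curvature, in dimension at least
three. -/
theorem scalar_curvature_eq (l : ι) :
    3 * (F * P.hor G l κ - P.Y l F * P.sprayDer G κ)
      = F * (P.sprayDer G (P.Y l κ) - ∑ m, P.Y m κ * P.Y l (G m)) := by
  have u2 : IsUnit ((Fintype.card ι : A) - 2) := by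
    simpa using isUnit_natCast_sub (A := A) (m := 2) (n := Fintype.card ι) (by omega)
  have DF : P.sprayDer G F = 0 := by simp [sprayDer_apply, h.hor_eq_zero]
  -- That is, $F_{\cdot l|0}=0$, because $F_{|m}=0$.
  have DFl : P.sprayDer G (P.Y l F) = ∑ m, P.Y m F * P.Y l (G m) := by
    have e : ∀ m, P.hor G m (P.Y l F) = ∑ s, P.Y l (P.Y m (G s)) * P.Y s F := by
      intro m
      have := P.Y_hor G l m F
      rw [h.hor_eq_zero, map_zero] at this
      linear_combination -this
    simp only [sprayDer_apply, e, Finset.mul_sum]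
    rw [Finset.sum_comm]
    refine Finset.sum_congr rfl fun s _ => ?_
    rw [← P.sum_Y_Y_mul_y G h.euler_spray s l, Finset.mul_sum]
    exact Finset.sum_congr rfl fun m _ => by rw [P.Y_Y l m]; ring
  have yN : ∀ k i, ∑ s, P.y s * P.Y s (P.Y k (G i)) = P.Y k (G i) := fun k i => by
    simpa only [mul_comm] using P.sum_Y_Y_mul_y G h.euler_spray i k
  have t1 : 3 * P.sprayDer G (∑ k, P.curv G k k l)
      = ((Fintype.card ι : A) - 2) * (F ^ 2 * P.sprayDer G (P.Y l κ))
      + 3 * ((Fintype.card ι : A) - 1) * (F * P.Y l F * P.sprayDer G κ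
          + κ * F * ∑ m, P.Y m F * P.Y l (G m)) := by
    have e := congrArg (P.sprayDer G) (h.trace_curv hn hR l)
    have n3 : P.sprayDer G (3 : A) = 0 := by simpa using Derivation.map_natCast (P.sprayDer G) 3
    have n2 : P.sprayDer G (2 : A) = 0 := by simpa using Derivation.map_natCast (P.sprayDer G) 2
    simp only [Derivation.leibniz, map_add, map_sub, Derivation.map_natCast, n3, n2, pow_two,
      Derivation.map_one_eq_zero, DF, DFl, smul_eq_mul] at e
    linear_combination e
  have t2 : 3 * ∑ m, (∑ k, P.curv G k k m) * P.Y l (G m)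
      = ((Fintype.card ι : A) - 2) * (F ^ 2 * ∑ m, P.Y m κ * P.Y l (G m))
      + 3 * ((Fintype.card ι : A) - 1) * (κ * F * ∑ m, P.Y m F * P.Y l (G m)) := by
    rw [Finset.mul_sum]
    simp only [← mul_assoc (3 : A) (∑ k, _), h.trace_curv hn hR, add_mul, Finset.sum_add_distrib]
    simp only [Finset.mul_sum]
    congr 1 <;> exact Finset.sum_congr rfl fun m _ => by ring
  have hR' : ∀ i k, P.riem G i k
      = (if i = k then κ * F ^ 2 else 0) - (κ * F * P.Y k F) * P.y i := by
    intro i k; rw [hR]; split_ifs <;> ring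
  have t3 : ∑ k, P.hor G k (P.riem G k l) = F ^ 2 * P.hor G l κ
      - F * P.Y l F * P.sprayDer G κ - κ * F * ∑ m, P.Y m F * P.Y l (G m)
      + κ * F * P.Y l F * ∑ k, P.Y k (G k) := by
    simp only [hR', map_sub, Finset.sum_sub_distrib, apply_ite (P.hor G _), map_zero]
    rw [Finset.sum_ite_eq' Finset.univ l]
    simp only [Derivation.leibniz _ _ (P.y _), smul_eq_mul, hor_y, if_true,
      Finset.sum_add_distrib, Finset.mem_univ, mul_neg, Finset.sum_neg_distrib,
      ← Finset.mul_sum, ← sprayDer_apply]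
    simp only [Derivation.leibniz, h.hor_sq, DF, DFl, smul_eq_mul]
    ring
  have t4 : ∑ s, P.riem G s l * ∑ k, P.Y s (P.Y k (G k))
      = κ * F ^ 2 * ∑ k, P.Y l (P.Y k (G k)) - κ * F * P.Y l F * ∑ k, P.Y k (G k) := by
    simp only [hR', sub_mul, Finset.sum_sub_distrib, ite_mul, zero_mul]
    rw [Finset.sum_ite_eq' Finset.univ l]
    simp only [Finset.mem_univ, if_true]
    congr 1
    simp only [Finset.mul_sum]
    rw [Finset.sum_comm]
    refine Finset.sum_congr rfl fun k _ => ?_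
    conv_rhs => rw [← yN k k, Finset.mul_sum]
    exact Finset.sum_congr rfl fun m _ => by ring
  have t5 : ∑ k, ∑ s, P.riem G s k * P.Y s (P.Y l (G k))
      = κ * F ^ 2 * ∑ k, P.Y l (P.Y k (G k)) - κ * F * ∑ m, P.Y m F * P.Y l (G m) := by
    simp only [hR', sub_mul, Finset.sum_sub_distrib, ite_mul, zero_mul]
    simp only [Finset.sum_ite_eq', Finset.mem_univ, if_true, mul_assoc, ← Finset.mul_sum, yN]
    simp only [P.Y_Y _ l]
  have t6 : P.hor G l (∑ k, P.riem G k k)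
      = ((Fintype.card ι : A) - 1) * (F ^ 2 * P.hor G l κ) := by
    rw [h.trace_riem hR]
    simp [Derivation.leibniz, h.hor_eq_zero]
  have b := P.trace_bianchi G h.euler_spray l
  rw [t3, t4, t5, t6] at b
  -- In `b` the terms with $G^k_{\cdot k}$, $G^k_{\cdot k\cdot l}$ and $F_{\cdot m}G^m_{\cdot l}$
  -- from `t3`, `t4`, `t5` cancel. The coefficient $3(n-1)$ of $FF_{\cdot l}\kappa_{|0}$ in `t1` is
  -- lowered to $3(n-2)$ by `t3`, so $(n-2)F$ factors out.
  refine (u2.mul h.isUnit).mul_left_cancel ?_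
  linear_combination -3 * b + t1 - t2

end Scalar

end IsGeodesicSpray
end PhaseAlgebra

/-! ### Smooth functions on an open set as a phase algebra. -/

section FunctionAlgebra

variable {n : ℕ} {V : Type*} [NormedAddCommGroup V] [NormedSpace ℝ V]

/-- The algebra of restrictions to `Ω` of functions that are smooth on `Ω`. -/
def smoothOn (Ω : Set V) : Subalgebra ℝ (Ω → ℝ) where
  carrier := {a | ∃ h : V → ℝ, ContDiffOn ℝ ∞ h Ω ∧ ∀ p : Ω, a p = h p}
  mul_mem' := by
    rintro a b ⟨h, hs, ha⟩ ⟨k, ks, kb⟩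
    exact ⟨fun p => h p * k p, hs.mul ks, fun p => by simp [ha, kb]⟩
  add_mem' := by
    rintro a b ⟨h, hs, ha⟩ ⟨k, ks, kb⟩
    exact ⟨fun p => h p + k p, hs.add ks, fun p => by simp [ha, kb]⟩
  algebraMap_mem' c := ⟨fun _ => c, contDiffOn_const, fun p => rfl⟩

namespace smoothOn

variable {Ω : Set V}

/-- Evaluation at a point. -/
def ev (p : Ω) : smoothOn Ω →ₐ[ℝ] ℝ :=
  (Pi.evalAlgHom ℝ (fun _ : Ω => ℝ) p).comp (smoothOn Ω).val

lemma ev_mk (p : Ω) (a : Ω → ℝ) (ha : a ∈ smoothOn Ω) : ev p ⟨a, ha⟩ = a p := rfl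

lemma ext_ev {a b : smoothOn Ω} (h : ∀ p, ev p a = ev p b) : a = b :=
  Subtype.ext (funext h)

/-- The extension of a function on `Ω` by zero. -/
def zeroExt (a : smoothOn Ω) : V → ℝ := Function.extend Subtype.val a.1 0

lemma zeroExt_apply (a : smoothOn Ω) (p : Ω) : zeroExt a p = ev p a :=
  Subtype.val_injective.extend_apply _ _ p

lemma contDiffOn_zeroExt (a : smoothOn Ω) : ContDiffOn ℝ ∞ (zeroExt a) Ω := by
  obtain ⟨h, hs, ha⟩ := a.2
  exact hs.congr fun p hp => (zeroExt_apply a ⟨p, hp⟩).trans (ha ⟨p, hp⟩)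

lemma isUnit_of_ev_ne_zero {a : smoothOn Ω} (h : ∀ p, ev p a ≠ 0) : IsUnit a := by
  have hb : (fun p => (a.1 p)⁻¹) ∈ smoothOn Ω :=
    ⟨fun p => (zeroExt a p)⁻¹, (contDiffOn_zeroExt a).inv fun p hp => by
      rw [zeroExt_apply a ⟨p, hp⟩]; exact h _, fun p => by simp only [zeroExt_apply]; rfl⟩
  refine IsUnit.of_mul_eq_one ⟨_, hb⟩ (ext_ev fun p => ?_)
  rw [map_mul, map_one, ev_mk]
  exact mul_inv_cancel₀ (h p)

variable (hΩ : IsOpen Ω)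
include hΩ

lemma differentiableAt_zeroExt (a : smoothOn Ω) (p : Ω) : DifferentiableAt ℝ (zeroExt a) p :=
  ((contDiffOn_zeroExt a).contDiffAt (hΩ.mem_nhds p.2)).differentiableAt (by simp)

/-- As $\Omega$ is open, derivatives at its points do not depend on the extension chosen. -/
lemma eventuallyEq_zeroExt {a : smoothOn Ω} {h : V → ℝ} (e : ∀ p : Ω, h p = ev p a) (p : Ω) :
    h =ᶠ[nhds p.1] zeroExt a := by
  filter_upwards [hΩ.mem_nhds p.2] with q hq
  exact (e ⟨q, hq⟩).trans (zeroExt_apply a ⟨q, hq⟩).symm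

lemma fderiv_eq_zeroExt {a : smoothOn Ω} {h : V → ℝ} (e : ∀ p : Ω, h p = ev p a) (p : Ω) :
    fderiv ℝ h p = fderiv ℝ (zeroExt a) p :=
  (eventuallyEq_zeroExt hΩ e p).fderiv_eq

/-- The directional derivative of a smooth function. -/
def dirDerFun (v : V) (a : smoothOn Ω) : smoothOn Ω :=
  ⟨fun p => fderiv ℝ (zeroExt a) p v, fun p => fderiv ℝ (zeroExt a) p v,
    ((contDiffOn_zeroExt a).fderiv_of_isOpen (m := ∞) hΩ le_rfl).clm_apply contDiffOn_const,
    fun _ => rfl⟩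

lemma ev_dirDerFun {a : smoothOn Ω} {h : V → ℝ} (e : ∀ p : Ω, h p = ev p a) (v : V) (p : Ω) :
    ev p (dirDerFun hΩ v a) = fderiv ℝ h p v := by
  rw [fderiv_eq_zeroExt hΩ e]; rfl

/-- The directional derivative, as a derivation of the algebra of smooth functions. -/
def dirDer (v : V) : Derivation ℝ (smoothOn Ω) (smoothOn Ω) :=
  Derivation.mk'
    { toFun := dirDerFun hΩ v
      map_add' := fun a b => ext_ev fun p => by
        rw [map_add, ev_dirDerFun hΩ (a := a + b) (h := zeroExt a + zeroExt b)
            (fun p => by rw [Pi.add_apply, zeroExt_apply, zeroExt_apply, map_add]),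
          fderiv_add (differentiableAt_zeroExt hΩ a p) (differentiableAt_zeroExt hΩ b p)]
        rfl
      map_smul' := fun c a => ext_ev fun p => by
        rw [map_smul, ev_dirDerFun hΩ (a := c • a) (h := c • zeroExt a)
            (fun p => by rw [Pi.smul_apply, zeroExt_apply, map_smul]),
          fderiv_const_smul (differentiableAt_zeroExt hΩ a p)]
        rfl }
    fun a b => ext_ev fun p => by
      simp only [smul_eq_mul, LinearMap.coe_mk, AddHom.coe_mk, map_add, map_mul]
      rw [ev_dirDerFun hΩ (a := a * b) (h := zeroExt a * zeroExt b)
          (fun p => by rw [Pi.mul_apply, zeroExt_apply, zeroExt_apply, map_mul]),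
          fderiv_mul (differentiableAt_zeroExt hΩ a p) (differentiableAt_zeroExt hΩ b p),
          zeroExt_apply, zeroExt_apply]
      rfl

lemma ev_dirDer {a : smoothOn Ω} {h : V → ℝ} (e : ∀ p : Ω, h p = ev p a) (v : V) (p : Ω) :
    fderiv ℝ h p v = ev p (dirDer hΩ v a) :=
  (ev_dirDerFun hΩ e v p).symm

lemma dirDer_comm (v w : V) (a : smoothOn Ω) :
    dirDer hΩ v (dirDer hΩ w a) = dirDer hΩ w (dirDer hΩ v a) := by
  refine ext_ev fun p => ?_
  have hs := (contDiffOn_zeroExt a).contDiffAt (hΩ.mem_nhds p.2)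
  have hd : DifferentiableAt ℝ (fderiv ℝ (zeroExt a)) p :=
    (hs.fderiv_right (m := 1) (by norm_cast)).differentiableAt (by simp)
  have key : ∀ v w : V, ev p (dirDer hΩ v (dirDer hΩ w a))
      = fderiv ℝ (fderiv ℝ (zeroExt a)) p v w := by
    intro v w
    rw [← ev_dirDer hΩ (h := fun q => fderiv ℝ (zeroExt a) q w) (fun q => rfl),
      fderiv_clm_apply hd (differentiableAt_const w)]
    simp
  rw [key, key]
  exact (hs.isSymmSndFDerivAt (by simpa using WithTop.coe_le_coe.2 (le_top : (2 : ℕ∞) ≤ ⊤))) v w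

end smoothOn

open smoothOn

variable {Ω : Set (E n × E n)}

/-- The coordinate function `y^i` as an element of `smoothOn Ω`. -/
def coordY (Ω : Set (E n × E n)) (i : Fin n) : smoothOn Ω :=
  ⟨fun p => p.1.2 i, fun p => p.2 i, by fun_prop, fun _ => rfl⟩

lemma ev_dirDer_coordY (hΩ : IsOpen Ω) (v : E n × E n) (p : Ω) (i : Fin n) :
    ev p (dirDer hΩ v (coordY Ω i)) = v.2 i := by
  rw [← ev_dirDer hΩ (h := ⇑((EuclideanSpace.proj i).comp (ContinuousLinearMap.snd ℝ (E n) (E n))))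
    (fun p => rfl), ContinuousLinearMap.fderiv]
  rfl

/-- The phase-space algebra of smooth functions on an open set of `ℝⁿ × ℝⁿ`. -/
def phase (hΩ : IsOpen Ω) : PhaseAlgebra (Fin n) (smoothOn Ω) where
  X k := dirDer hΩ (EuclideanSpace.single k 1, 0)
  Y k := dirDer hΩ (0, EuclideanSpace.single k 1)
  y := coordY Ω
  X_X i j := dirDer_comm hΩ _ _
  X_Y i j := dirDer_comm hΩ _ _
  Y_Y i j := dirDer_comm hΩ _ _
  X_y i j := ext_ev fun p => by rw [ev_dirDer_coordY, map_zero]; rfl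
  Y_y i j := ext_ev fun p => by
    rw [ev_dirDer_coordY]
    by_cases h : i = j
    · simp [h]
    · simp [h, Ne.symm h]

/-- `T` restricts to the element `a` of `smoothOn Ω`. -/
def Represents (T : E n → E n → ℝ) (a : smoothOn Ω) : Prop := ∀ p : Ω, T p.1.1 p.1.2 = ev p a

namespace Represents

variable {T : E n → E n → ℝ} {a : smoothOn Ω} (hΩ : IsOpen Ω) (h : Represents T a)
include hΩ h

lemma hasFDerivAt (p : Ω) : HasFDerivAt (fun q : E n × E n => T q.1 q.2)
    (fderiv ℝ (fun q : E n × E n => T q.1 q.2) p) p :=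
  ((eventuallyEq_zeroExt hΩ (h := fun q : E n × E n => T q.1 q.2) h p).differentiableAt_iff.2
    (differentiableAt_zeroExt hΩ a p)).hasFDerivAt

lemma dx (k : Fin n) : Represents (dx k T) ((phase hΩ).X k a) := by
  intro p
  refine Eq.trans ?_ (ev_dirDer hΩ (h := fun q : E n × E n => T q.1 q.2) h
    (EuclideanSpace.single k 1, 0) p)
  have := HasFDerivAt.comp (f := fun x' : E n => (x', p.1.2)) p.1.1 (h.hasFDerivAt hΩ p)
    ((hasFDerivAt_id _).prodMk (hasFDerivAt_const _ _))
  exact congrArg (· (EuclideanSpace.single k 1)) this.fderiv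

lemma dy (k : Fin n) : Represents (dy k T) ((phase hΩ).Y k a) := by
  intro p
  refine Eq.trans ?_ (ev_dirDer hΩ (h := fun q : E n × E n => T q.1 q.2) h
    (0, EuclideanSpace.single k 1) p)
  have := HasFDerivAt.comp (f := fun y' : E n => (p.1.1, y')) p.1.2 (h.hasFDerivAt hΩ p)
    ((hasFDerivAt_const _ _).prodMk (hasFDerivAt_id _))
  exact congrArg (· (EuclideanSpace.single k 1)) this.fderiv

end Represents

end FunctionAlgebra

/-! ### Flag curvatures determine a self-adjoint curvature operator. -/

section LinearAlgebra

variable {ι : Type*} [Fintype ι]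

lemma matrix_eq_zero_of_quadratic [DecidableEq ι] {B : Matrix ι ι ℝ} (hB : Bᵀ = B)
    (h : ∀ u, u ⬝ᵥ B *ᵥ u = 0) : B = 0 := by
  ext i j
  have e := h (Pi.single i 1 + Pi.single j 1)
  have ei := h (Pi.single i 1)
  have ej := h (Pi.single j 1)
  have s : B j i = B i j := congrFun (congrFun hB i) j
  simp [Matrix.mulVec_add, add_dotProduct, dotProduct_add] at e ei ej
  simp only [Matrix.zero_apply]
  linarith

lemma PosDef.flag_denominator_pos {g : Matrix ι ι ℝ} (hg : g.PosDef) {y u : ι → ℝ}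
    (h : LinearIndependent ℝ ![y, u]) :
    0 < (y ⬝ᵥ g *ᵥ y) * (u ⬝ᵥ g *ᵥ u) - (y ⬝ᵥ g *ᵥ u) ^ 2 := by
  have hy : y ≠ 0 := h.ne_zero 0
  have hs : 0 < y ⬝ᵥ g *ᵥ y := by simpa using hg.dotProduct_mulVec_pos hy
  have hsymm : u ⬝ᵥ g *ᵥ y = y ⬝ᵥ g *ᵥ u := by
    have ht : gᵀ = g := by simpa using hg.isHermitian.eq
    rw [Matrix.dotProduct_mulVec, ← Matrix.mulVec_transpose, ht, dotProduct_comm]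
  -- Cauchy–Schwarz: the squared $g$-length of this vector is $g(y,y)$ times the denominator.
  have hz : (y ⬝ᵥ g *ᵥ y) • u - (y ⬝ᵥ g *ᵥ u) • y ≠ 0 := by
    intro h0
    have := (LinearIndependent.pair_iff.1 h (-(y ⬝ᵥ g *ᵥ u)) (y ⬝ᵥ g *ᵥ y)
      (by rw [← h0, neg_smul]; abel)).2
    exact hs.ne' this
  have hp := hg.dotProduct_mulVec_pos hz
  simp only [star_trivial, Matrix.mulVec_sub, Matrix.mulVec_smul, sub_dotProduct, dotProduct_sub,
    smul_dotProduct, dotProduct_smul, smul_eq_mul, hsymm] at hp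
  refine (pos_iff_pos_of_mul_pos (a := y ⬝ᵥ g *ᵥ y) ?_).1 hs
  linarith

/-- A self-adjoint curvature operator with constant flag curvatures is determined by them. -/
lemma curvature_eq_of_flag [DecidableEq ι] {g R : Matrix ι ι ℝ} (hg : g.PosDef) {y : ι → ℝ}
    {K : ℝ} (hy : y ≠ 0) (hR : (g * R)ᵀ = g * R) (hRy : R *ᵥ y = 0)
    (hK : ∀ u, LinearIndependent ℝ ![y, u] → (u ⬝ᵥ (g * R) *ᵥ u) /
      ((y ⬝ᵥ g *ᵥ y) * (u ⬝ᵥ g *ᵥ u) - (y ⬝ᵥ g *ᵥ u) ^ 2) = K) :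
    R = K • ((y ⬝ᵥ g *ᵥ y) • (1 : Matrix ι ι ℝ) - Matrix.vecMulVec y (g *ᵥ y)) := by
  have ht : gᵀ = g := by simpa using hg.isHermitian.eq
  have hsymm : ∀ u, u ⬝ᵥ g *ᵥ y = y ⬝ᵥ g *ᵥ u := fun u => by
    rw [Matrix.dotProduct_mulVec, ← Matrix.mulVec_transpose, ht, dotProduct_comm]
  have hB : g * R - K • ((y ⬝ᵥ g *ᵥ y) • g - Matrix.vecMulVec (g *ᵥ y) (g *ᵥ y)) = 0 := by
    refine matrix_eq_zero_of_quadratic ?_ fun u => ?_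
    · rw [Matrix.transpose_sub, hR, Matrix.transpose_smul, Matrix.transpose_sub,
        Matrix.transpose_smul, ht, Matrix.transpose_vecMulVec]
    · have e : u ⬝ᵥ (g * R - K • ((y ⬝ᵥ g *ᵥ y) • g
          - Matrix.vecMulVec (g *ᵥ y) (g *ᵥ y))) *ᵥ u = u ⬝ᵥ (g * R) *ᵥ u
          - K * ((y ⬝ᵥ g *ᵥ y) * (u ⬝ᵥ g *ᵥ u) - (y ⬝ᵥ g *ᵥ u) ^ 2) := by
        simp only [Matrix.sub_mulVec, Matrix.smul_mulVec, dotProduct_sub, dotProduct_smul,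
          smul_eq_mul, Matrix.vecMulVec_mulVec, hsymm]
        simp [dotProduct_comm _ u, hsymm]
        left; ring
      rw [e]
      by_cases hu : LinearIndependent ℝ ![y, u]
      · rw [← hK u hu, div_mul_cancel₀ _ (PosDef.flag_denominator_pos hg hu).ne', sub_self]
      -- For $u=cy$ both quadratic forms vanish, since $Ry=0$.
      · rw [LinearIndependent.pair_iff' hy] at hu
        push Not at hu
        obtain ⟨c, rfl⟩ := hu
        simp only [← Matrix.mulVec_mulVec, Matrix.mulVec_smul, hRy, Matrix.mulVec_zero, smul_zero,
          dotProduct_zero, smul_dotProduct, dotProduct_smul, smul_eq_mul]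
        ring
  have hd : IsUnit g.det := hg.det_pos.ne'.isUnit
  have h2 : g * (R - K • ((y ⬝ᵥ g *ᵥ y) • (1 : Matrix ι ι ℝ)
      - Matrix.vecMulVec y (g *ᵥ y))) = 0 := by
    rw [← hB, mul_sub, Matrix.mul_smul, mul_sub, Matrix.mul_smul, mul_one, Matrix.mul_vecMulVec]
  have h3 := congrArg (g⁻¹ * ·) h2
  simp only [Matrix.nonsing_inv_mul_cancel_left _ _ hd, mul_zero] at h3
  exact sub_eq_zero.1 h3

end LinearAlgebra

/-! ### Finsler metrics on an open set of $\mathbb R^n\times\mathbb R^n$. -/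

section Local

open smoothOn

variable {n : ℕ} {Ω : Set (E n × E n)} (hΩ : IsOpen Ω)

/-- The fundamental tensor with entries in `smoothOn Ω`. -/
def fundMatrix (Fa : smoothOn Ω) : Matrix (Fin n) (Fin n) (smoothOn Ω) :=
  Matrix.of fun i j => (1 / 2 : ℝ) • (phase hΩ).Y j ((phase hΩ).Y i (Fa ^ 2))

/-- The geodesic coefficients as elements of `smoothOn Ω`. -/
def geoCoeff (Fa : smoothOn Ω) (i : Fin n) : smoothOn Ω :=
  (1 / 4 : ℝ) • ∑ l, (fundMatrix hΩ Fa)⁻¹ i l *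
    (∑ m, (phase hΩ).X m ((phase hΩ).Y l (Fa ^ 2)) * (phase hΩ).y m - (phase hΩ).X l (Fa ^ 2))

lemma Represents.sq {T : E n → E n → ℝ} {a : smoothOn Ω} (h : Represents T a) :
    Represents (fun x y => T x y ^ 2) (a ^ 2) := fun p => by rw [map_pow, ← h p]

lemma Represents.hderiv {f T : E n → E n → ℝ} {G : Fin n → smoothOn Ω} {a : smoothOn Ω}
    (hG : ∀ i, Represents (geodesicCoeff f i) (G i)) (h : Represents T a) (m : Fin n) :
    Represents (hderiv f m T) ((phase hΩ).hor G m a) := fun p => by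
  simp only [Finsler.hderiv, PhaseAlgebra.hor_apply, map_sub, map_sum, map_mul, h.dx hΩ m p,
    h.dy hΩ _ p, (hG _).dy hΩ _ p]

lemma Represents.hderivZero {f T : E n → E n → ℝ} {G : Fin n → smoothOn Ω} {a : smoothOn Ω}
    (hG : ∀ i, Represents (geodesicCoeff f i) (G i)) (h : Represents T a) :
    Represents (hderivZero f T) ((phase hΩ).sprayDer G a) := fun p => by
  simp only [Finsler.hderivZero, PhaseAlgebra.sprayDer_apply, map_sum, map_mul,
    h.hderiv hΩ hG _ p]
  exact Finset.sum_congr rfl fun m _ => mul_comm _ _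

lemma represents_riemannCurvature {f : E n → E n → ℝ} {G : Fin n → smoothOn Ω}
    (hG : ∀ i, Represents (geodesicCoeff f i) (G i)) (i k : Fin n) :
    Represents (riemannCurvature f i k) ((phase hΩ).riem G i k) := fun p => by
  simp only [riemannCurvature, PhaseAlgebra.riem, map_sub, map_add, map_sum, map_mul, map_ofNat,
    (hG _).dx hΩ _ p, (hG _).dy hΩ _ p, ((hG _).dy hΩ _).dx hΩ _ p, ((hG _).dy hΩ _).dy hΩ _ p,
    hG _ p]
  rfl

variable {f : E n → E n → ℝ} {Fa : smoothOn Ω} (hF : Represents f Fa)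
include hF

lemma map_fundMatrix (p : Ω) : (fundMatrix hΩ Fa).map (ev p) = fundTensor f p.1.1 p.1.2 := by
  ext i j
  simp only [fundMatrix, Matrix.map_apply, Matrix.of_apply, fundTensor, map_smul, smul_eq_mul,
    (hF.sq.dy hΩ i).dy hΩ j p]

variable (hg : ∀ p : Ω, (fundTensor f p.1.1 p.1.2).PosDef)
include hg

lemma isUnit_det_fundMatrix : IsUnit (fundMatrix hΩ Fa).det := by
  refine isUnit_of_ev_ne_zero fun p => ?_
  rw [AlgHom.map_det, AlgHom.mapMatrix_apply, map_fundMatrix hΩ hF]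
  exact (hg p).det_pos.ne'

lemma represents_geodesicCoeff (i : Fin n) :
    Represents (geodesicCoeff f i) (geoCoeff hΩ Fa i) := fun p => by
  have hinv : (fundTensor f p.1.1 p.1.2)⁻¹ = (fundMatrix hΩ Fa)⁻¹.map (ev p) := by
    refine Matrix.inv_eq_right_inv ?_
    rw [← map_fundMatrix hΩ hF, ← Matrix.map_mul,
      Matrix.mul_nonsing_inv _ (isUnit_det_fundMatrix hΩ hF hg)]
    exact Matrix.map_one _ (map_zero _) (map_one _)
  simp only [geodesicCoeff, geoCoeff, hinv, map_smul, map_sum, map_mul, map_sub, smul_eq_mul,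
    (hF.sq.dy hΩ _).dx hΩ _ p, hF.sq.dx hΩ _ p, Matrix.map_apply]
  rfl

lemma isGeodesicSpray (h0 : ∀ p : Ω, f p.1.1 p.1.2 ≠ 0)
    (he : ∀ p : Ω, ∑ l, p.1.2 l * dy l f p.1.1 p.1.2 = f p.1.1 p.1.2) :
    (phase hΩ).IsGeodesicSpray (geoCoeff hΩ Fa) Fa := by
  have hd := isUnit_det_fundMatrix hΩ hF hg
  have hY : ∀ l i, (phase hΩ).Y i ((phase hΩ).Y l (Fa ^ 2)) = 2 * fundMatrix hΩ Fa l i := by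
    intro l i
    rw [fundMatrix, Matrix.of_apply, two_mul, ← add_smul]; norm_num
  refine ⟨isUnit_of_ev_ne_zero fun p => by rw [← hF p]; exact h0 p, ext_ev fun p => ?_,
    fun v hv i => ?_, fun l => ?_⟩
  · rw [PhaseAlgebra.euler_apply, map_sum, ← hF p, ← he p]
    refine Finset.sum_congr rfl fun l _ => ?_
    rw [map_mul, ← hF.dy hΩ l p]; rfl
  · have u2 : IsUnit (2 : smoothOn Ω) := by
      simpa using isUnit_natCast_sub (A := smoothOn Ω) (m := 0) (n := 2) (by simp)
    have : fundMatrix hΩ Fa *ᵥ v = 0 := by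
      ext1 l
      refine u2.mul_left_cancel ?_
      rw [Pi.zero_apply, mul_zero, ← hv l]
      simp only [hY, Matrix.mulVec, dotProduct, Finset.mul_sum, mul_assoc]
    have h2 := congrArg ((fundMatrix hΩ Fa)⁻¹ *ᵥ ·) this
    simp only [Matrix.mulVec_mulVec, Matrix.nonsing_inv_mul _ hd, Matrix.one_mulVec,
      Matrix.mulVec_zero] at h2
    exact congrFun h2 i
  · set S : Fin n → smoothOn Ω := fun l => ∑ m, (phase hΩ).X m ((phase hΩ).Y l (Fa ^ 2)) *
      (phase hΩ).y m - (phase hΩ).X l (Fa ^ 2) with hS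
    have e : geoCoeff hΩ Fa = (1 / 4 : ℝ) • ((fundMatrix hΩ Fa)⁻¹ *ᵥ S) := rfl
    have e2 : ∑ i, fundMatrix hΩ Fa l i * geoCoeff hΩ Fa i = (1 / 4 : ℝ) • S l := by
      have : fundMatrix hΩ Fa *ᵥ geoCoeff hΩ Fa = (1 / 4 : ℝ) • S := by
        rw [e, Matrix.mulVec_smul, Matrix.mulVec_mulVec, Matrix.mul_nonsing_inv _ hd,
          Matrix.one_mulVec]
      exact congrFun this l
    simp only [hY, mul_assoc, ← Finset.mul_sum, e2]
    refine ext_ev fun p => ?_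
    simp only [map_mul, map_smul, smul_eq_mul, map_ofNat]
    rw [← show ev p (S l) = _ from rfl]
    ring

/-- The curvature equation of Finsler metrics of scalar flag curvature on an open set of
`ℝⁿ × ℝⁿ`. -/
theorem scalar_flag_curvature_local (hn : 3 ≤ n) (hy : ∀ p : Ω, p.1.2 ≠ 0)
    (h0 : ∀ p : Ω, f p.1.1 p.1.2 ≠ 0)
    (he : ∀ p : Ω, ∑ l, p.1.2 l * dy l f p.1.1 p.1.2 = f p.1.1 p.1.2)
    {κ : E n → E n → ℝ} (hK : ∀ p : Ω, ∀ u, LinearIndependent ℝ ![p.1.2, u] →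
      flagCurvature f p.1.1 p.1.2 u = κ p.1.1 p.1.2) :
    ∃ κa : smoothOn Ω, Represents κ κa ∧
      ∀ i k, (phase hΩ).riem (geoCoeff hΩ Fa) i k
        = κa * ((if i = k then Fa ^ 2 else 0) - Fa * (phase hΩ).Y k Fa * (phase hΩ).y i) := by
  have hs := isGeodesicSpray hΩ hF hg h0 he
  have hG := represents_geodesicCoeff hΩ hF hg
  -- $g_{ki}y^i=FF_{\cdot k}$, by Euler's relation for $[F^2]_{\cdot k}$.
  have hgy : ∀ (p : Ω) (k : Fin n), (fundTensor f p.1.1 p.1.2 *ᵥ p.1.2) k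
      = ev p (Fa * (phase hΩ).Y k Fa) := by
    intro p k
    have e2 : (phase hΩ).Y k (Fa ^ 2) = 2 * (Fa * (phase hΩ).Y k Fa) := by
      rw [pow_two, Derivation.leibniz, smul_eq_mul, two_mul]
    have e := congrArg (ev p) ((hs.euler_Y_sq k).trans e2)
    rw [PhaseAlgebra.euler_apply, map_sum, map_mul, map_ofNat] at e
    rw [← map_fundMatrix hΩ hF, Matrix.mulVec, dotProduct]
    simp only [Matrix.map_apply, fundMatrix, Matrix.of_apply, map_smul, smul_eq_mul,
      mul_assoc, ← Finset.mul_sum]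
    have e' : ∑ i, ev p ((phase hΩ).Y i ((phase hΩ).Y k (Fa ^ 2))) * p.1.2 i
        = ∑ i, ev p ((phase hΩ).y i * (phase hΩ).Y i ((phase hΩ).Y k (Fa ^ 2))) :=
      Finset.sum_congr rfl fun i _ => by rw [map_mul]; exact mul_comm _ _
    rw [e', e]
    ring
  have hyy : ∀ p : Ω, p.1.2 ⬝ᵥ fundTensor f p.1.1 p.1.2 *ᵥ p.1.2 = ev p (Fa ^ 2) := by
    intro p
    have e := congrArg (ev p) hs.euler_eq
    rw [PhaseAlgebra.euler_apply, map_sum] at e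
    simp only [dotProduct, hgy]
    rw [pow_two, map_mul]
    conv_rhs => enter [2]; rw [← e]
    rw [Finset.mul_sum]
    refine Finset.sum_congr rfl fun i _ => ?_
    rw [map_mul, map_mul]
    change _ = _ * (p.1.2 i * _)
    ring
  have hR : ∀ (p : Ω) (i k : Fin n), riemannCurvature f i k p.1.1 p.1.2
      = κ p.1.1 p.1.2 * ev p ((if i = k then Fa ^ 2 else 0)
        - Fa * (phase hΩ).Y k Fa * (phase hΩ).y i) := by
    intro p i k
    set g := fundTensor f p.1.1 p.1.2 with hgdef
    have ht : gᵀ = g := by simpa using (hg p).isHermitian.eq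
    set R : Matrix (Fin n) (Fin n) ℝ :=
      Matrix.of fun i k => riemannCurvature f i k p.1.1 p.1.2 with hRdef
    have hRev : ∀ i k, R i k = ev p ((phase hΩ).riem (geoCoeff hΩ Fa) i k) :=
      fun i k => represents_riemannCurvature hΩ hG i k p
    have key := curvature_eq_of_flag (g := g) (R := R) (hg p) (y := p.1.2)
      (K := κ p.1.1 p.1.2) (fun h => hy p (by ext i; exact congrFun h i)) ?_ ?_ ?_
    · have := congrFun (congrFun key i) k
      rw [hyy] at this
      refine this.trans ?_
      simp only [Matrix.smul_apply, Matrix.sub_apply, Matrix.vecMulVec_apply, smul_eq_mul,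
        Matrix.one_apply, map_sub, map_mul, apply_ite (ev p), map_zero, mul_ite, mul_one, mul_zero]
      rw [show ev p ((phase hΩ).y i) = p.1.2 i from rfl, hgdef, hgy, map_mul]
      ring
    · ext k m
      have e := congrArg (ev p) (hs.riem_symm k m)
      simp only [map_sum, map_mul] at e
      simp only [Matrix.transpose_apply, Matrix.mul_apply, hRev, hgdef, ← map_fundMatrix hΩ hF,
        Matrix.map_apply, fundMatrix, Matrix.of_apply, map_smul, smul_eq_mul, mul_assoc,
        ← Finset.mul_sum]
      rw [← sub_eq_zero] at e ⊢
      simp only [(phase hΩ).Y_Y m, (phase hΩ).Y_Y k] at e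
      linarith
    · ext i
      have e := congrArg (ev p) (hs.sum_riem_mul_y i)
      simp only [map_sum, map_mul, map_zero] at e
      simp only [Matrix.mulVec, dotProduct, hRev, Pi.zero_apply]
      exact e
    · intro u hu
      have hu' : LinearIndependent ℝ ![p.1.2, WithLp.toLp 2 u] := by
        rw [LinearIndependent.pair_iff] at hu ⊢
        intro s t hst
        exact hu s t (congrArg (fun v : E n => v.ofLp) hst)
      rw [← hK p _ hu', flagCurvature, hyy, map_pow, ← hF p]
      congr 1
      · simp only [dotProduct, Matrix.mulVec, Matrix.mul_apply, Finset.mul_sum, Finset.sum_mul]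
        conv_rhs => rw [Finset.sum_comm]; enter [2, m]; rw [Finset.sum_comm]
        refine Finset.sum_congr rfl fun m _ => Finset.sum_congr rfl fun k _ =>
          Finset.sum_congr rfl fun i _ => ?_
        have hgs : g i m = g m i := congrFun (congrFun ht m) i
        change _ = g i m * R i k * u k * u m
        rw [hgs]
        ring
      · congr 2
        · simp only [dotProduct, Matrix.mulVec, Finset.mul_sum]
          refine Finset.sum_congr rfl fun i _ => Finset.sum_congr rfl fun j _ => ?_
          change _ = g i j * u i * u j
          ring
        · simp only [dotProduct, Matrix.mulVec, Finset.mul_sum]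
          refine Finset.sum_congr rfl fun i _ => Finset.sum_congr rfl fun j _ => ?_
          change _ = g i j * _ * u j
          ring
  -- No smoothness of $\kappa$ is assumed; it follows from $\kappa=R^k_k/((n-1)F^2)$.
  have u1 : IsUnit ((n : smoothOn Ω) - 1) := by
    simpa using isUnit_natCast_sub (A := smoothOn Ω) (m := 1) (n := n) (by omega)
  obtain ⟨w, hw⟩ := u1.mul (hs.isUnit.pow 2)
  set κa : smoothOn Ω := (∑ k, (phase hΩ).riem (geoCoeff hΩ Fa) k k) * ↑w⁻¹ with hκa
  have hrep : Represents κ κa := by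
    intro p
    have e : ev p (∑ k, (phase hΩ).riem (geoCoeff hΩ Fa) k k)
        = κ p.1.1 p.1.2 * ev p (w : smoothOn Ω) := by
      have e1 : ev p (∑ k, Fa * (phase hΩ).Y k Fa * (phase hΩ).y k) = ev p (Fa ^ 2) := by
        rw [pow_two, ← congrArg (Fa * ·) hs.euler_eq, PhaseAlgebra.euler_apply, Finset.mul_sum]
        congr 1
        exact Finset.sum_congr rfl fun l _ => by ring
      rw [map_sum]
      simp only [← represents_riemannCurvature hΩ hG _ _ p, hR, ← Finset.mul_sum]
      rw [← map_sum, Finset.sum_sub_distrib, map_sub, e1, hw]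
      simp
      left; ring
    rw [hκa, map_mul, e, mul_assoc, ← map_mul, Units.mul_inv, map_one, mul_one]
  refine ⟨κa, hrep, fun i k => ext_ev fun p => ?_⟩
  rw [← represents_riemannCurvature hΩ hG i k p, hR, map_mul, ← hrep p]

include hΩ in
/-- The equations for the scalar flag curvature on an open set of `ℝⁿ × ℝⁿ`. -/
theorem scalar_flag_curvature_eq (hn : 3 ≤ n) (hy : ∀ p : Ω, p.1.2 ≠ 0)
    (h0 : ∀ p : Ω, f p.1.1 p.1.2 ≠ 0)
    (he : ∀ p : Ω, ∑ l, p.1.2 l * dy l f p.1.1 p.1.2 = f p.1.1 p.1.2)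
    {κ : E n → E n → ℝ} (hK : ∀ p : Ω, ∀ u, LinearIndependent ℝ ![p.1.2, u] →
      flagCurvature f p.1.1 p.1.2 u = κ p.1.1 p.1.2) {x y : E n} (hp : (x, y) ∈ Ω) (k : Fin n) :
    (f x y * hderiv f k κ x y - dy k f x y * hderivZero f κ x y
        - (1 / 3) * f x y * hderivCovectorZero f (fun j => dy j κ) k x y = 0) ∧
      dy k (fun x y => hderivZero f κ x y / f x y) x y
        = (4 / 3) * (hderivCovectorZero f (fun j => dy j κ) k x y / f x y) := by
  have hs := isGeodesicSpray hΩ hF hg h0 he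
  have hG := represents_geodesicCoeff hΩ hF hg
  obtain ⟨κa, hκ, hR⟩ := scalar_flag_curvature_local hΩ hF hg hn hy h0 he hK
  set P := phase hΩ
  set G := geoCoeff hΩ Fa
  set p : Ω := ⟨(x, y), hp⟩ with hpdef
  have main := congrArg (ev p) (hs.scalar_curvature_eq (by simpa using hn) hR k)
  have hcov : hderivCovectorZero f (fun j => dy j κ) k x y
      = ev p (P.sprayDer G (P.Y k κa) - ∑ m, P.Y m κa * P.Y k (G m)) := by
    rw [← P.sum_y_mul_berwald G hs.euler_spray, P.sprayDer_apply, ← Finset.sum_sub_distrib, map_sum]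
    refine Finset.sum_congr rfl fun m _ => ?_
    have e1 : hderiv f m (dy k κ) x y = ev p (P.hor G m (P.Y k κa)) :=
      (hκ.dy hΩ k).hderiv hΩ hG m p
    have e2 : ∀ l, dy m (dy k (geodesicCoeff f l)) x y = ev p (P.Y m (P.Y k (G l))) :=
      fun l => ((hG l).dy hΩ k).dy hΩ m p
    have e3 : ∀ l, dy l κ x y = ev p (P.Y l κa) := fun l => hκ.dy hΩ l p
    rw [← mul_sub, map_mul, map_sub, map_sum, hderivCovector, e1, mul_comm]
    simp only [map_mul, e2, e3]
    rfl
  have a1 : f x y = ev p Fa := hF p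
  have a2 : hderiv f k κ x y = ev p (P.hor G k κa) := hκ.hderiv hΩ hG k p
  have a3 : dy k f x y = ev p (P.Y k Fa) := hF.dy hΩ k p
  have a4 : hderivZero f κ x y = ev p (P.sprayDer G κa) := hκ.hderivZero hΩ hG p
  have hne : ev p Fa ≠ 0 := by rw [← a1]; exact h0 p
  set C := P.sprayDer G (P.Y k κa) - ∑ m, P.Y m κa * P.Y k (G m)
  simp only [map_mul, map_sub, map_ofNat] at main
  refine ⟨?_, ?_⟩
  · rw [a1, a2, a3, a4, hcov]
    linarith
  · obtain ⟨w, hw⟩ := hs.isUnit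
    set W := P.sprayDer G κa * ↑w⁻¹ with hW
    have hWF : W * Fa = P.sprayDer G κa := by rw [hW, ← hw, mul_assoc, Units.inv_mul, mul_one]
    have hrep : Represents (fun x y => hderivZero f κ x y / f x y) W := fun q => by
      have e := congrArg (ev q) hWF
      have hq : ev q Fa ≠ 0 := by rw [← hF q]; exact h0 q
      rw [map_mul] at e
      change hderivZero f κ q.1.1 q.1.2 / f q.1.1 q.1.2 = _
      rw [hκ.hderivZero hΩ hG q, hF q, div_eq_iff hq, e]
    have e1 := congrArg (ev p) (congrArg (P.Y k) hWF)
    rw [P.Y_sprayDer G hs.euler_spray, Derivation.leibniz] at e1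
    have e2 := congrArg (ev p) hWF
    simp only [map_add, map_mul, smul_eq_mul] at e1 e2
    rw [hrep.dy hΩ k p, hcov, a1, ← mul_div_assoc, eq_div_iff hne]
    refine mul_left_cancel₀ hne ?_
    -- With $W=\kappa_{|0}/F$, $F^2W_{\cdot k}=F\kappa_{|k}-F_{\cdot k}\kappa_{|0}+F\kappa_{\cdot
    -- k|0}$. By `main` the first two terms give $\tfrac13F\kappa_{\cdot k|0}$, hence $\tfrac43$.
    linear_combination ev p Fa * e1 + main / 3 - ev p (P.Y k Fa) * e2

end Local

/-! ### From the manifold to a chart. -/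

variable {n : ℕ} {M : Type*} [TopologicalSpace M] [ChartedSpace (E n) M]

lemma contMDiff_tangentBundle_mk : ContMDiff 𝓘(ℝ, E n × E n) (𝓡 n).tangent ∞
    (fun q : E n × E n => (⟨q.1, q.2⟩ : TangentBundle (𝓡 n) (E n))) := by
  rw [modelWithCornersSelf_prod]
  exact contMDiff_tangentBundleModelSpaceHomeomorph_symm (I := 𝓡 n) (n := ∞)

lemma inChart_smul [IsManifold (𝓡 n) ∞ M] {F : TangentBundle (𝓡 n) M → ℝ} (hF : IsFinslerMetric F)
    (e : OpenPartialHomeomorph M (E n)) (x y : E n) {c : ℝ}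
    (hc : 0 ≤ c) : inChart e F x (c • y) = c * inChart e F x y := by
  have : tangentMap (𝓡 n) (𝓡 n) e.symm ⟨x, c • y⟩
      = ⟨e.symm x, c • (tangentMap (𝓡 n) (𝓡 n) e.symm ⟨x, y⟩).2⟩ :=
    congrArg (Bundle.TotalSpace.mk (e.symm x)) (map_smul (mfderiv (𝓡 n) (𝓡 n) e.symm x) c y)
  rw [inChart, this]
  exact hF.homogeneous (e.symm x) (mfderiv (𝓡 n) (𝓡 n) e.symm x y) c hc

lemma euler_of_homogeneous {f : E n → E n → ℝ} {x y : E n}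
    (hd : DifferentiableAt ℝ (f x) y)
    (hom : ∀ c : ℝ, 0 ≤ c → f x (c • y) = c * f x y) :
    ∑ l, y l * dy l f x y = f x y := by
  have h1 : fderiv ℝ (f x) y y = ∑ l, y l * dy l f x y := by
    have hy : y = ∑ l, y l • EuclideanSpace.single l (1 : ℝ) := by
      ext i; simp [Finset.sum_apply, Pi.single_apply]
    conv_lhs => rw [hy, map_sum]
    rw [← hy]
    simp [dy]
  rw [← h1]
  have h2 : HasDerivAt (fun t : ℝ => f x (t • y)) (fderiv ℝ (f x) y y) 1 := by
    have hl : HasDerivAt (fun t : ℝ => t • y) y 1 := by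
      simpa using (hasDerivAt_id (1 : ℝ)).smul_const y
    have hd' : HasFDerivAt (f x) (fderiv ℝ (f x) y) ((1 : ℝ) • y) := by
      rw [one_smul]; exact hd.hasFDerivAt
    exact hd'.comp_hasDerivAt 1 hl
  have h3 : HasDerivAt (fun t : ℝ => f x (t • y)) (f x y) 1 := by
    have : HasDerivAt (fun t : ℝ => t * f x y) (f x y) 1 := by
      simpa using (hasDerivAt_id (1 : ℝ)).mul_const (f x y)
    refine this.congr_of_eventuallyEq ?_
    -- Homogeneity holds only for nonnegative factors, which suffices near $t=1$.
    filter_upwards [Ioi_mem_nhds (zero_lt_one (α := ℝ))] with t ht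
    exact hom t (le_of_lt ht)
  exact h2.unique h3

variable {e : OpenPartialHomeomorph M (E n)}
  (he : e ∈ IsManifold.maximalAtlas (𝓡 n) ∞ M)
include he

lemma tangentMap_symm_snd_ne_zero {x y : E n} (hx : x ∈ e.target) (hy : y ≠ 0) :
    (tangentMap (𝓡 n) (𝓡 n) e.symm ⟨x, y⟩).2 ≠ 0 := by
  have hm : e.MDifferentiable (𝓡 n) (𝓡 n) :=
    ⟨(contMDiffOn_of_mem_maximalAtlas he).mdifferentiableOn (by simp),
      (contMDiffOn_symm_of_mem_maximalAtlas he).mdifferentiableOn (by simp)⟩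
  intro h0
  refine hy (hm.symm.mfderiv_injective hx ?_)
  exact h0.trans (map_zero _).symm

lemma contDiffOn_inChart [IsManifold (𝓡 n) ∞ M] {F : TangentBundle (𝓡 n) M → ℝ}
    (hF : IsFinslerMetric F) :
    ContDiffOn ℝ ∞ (fun q : E n × E n => inChart e F q.1 q.2)
      {q | q.1 ∈ e.target ∧ q.2 ≠ 0} := by
  have : IsManifold (𝓡 n) 1 M := IsManifold.of_le (n := ∞) (by simp)
  have hs := contMDiffOn_symm_of_mem_maximalAtlas he
  have hT := hs.contMDiffOn_tangentMapWithin (m := ∞) le_rfl e.open_target.uniqueMDiffOn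
  rw [← contMDiffOn_iff_contDiffOn]
  have h1 : ContMDiffOn 𝓘(ℝ, E n × E n) (𝓡 n).tangent ∞
      (fun q : E n × E n => tangentMap (𝓡 n) (𝓡 n) e.symm ⟨q.1, q.2⟩)
      {q | q.1 ∈ e.target ∧ q.2 ≠ 0} := by
    refine (hT.comp contMDiff_tangentBundle_mk.contMDiffOn (fun q hq => hq.1)).congr
      fun q hq => ?_
    -- Smoothness is known for the tangent map within `e.target`; on this open set it agrees with
    -- the full one used in `inChart`.
    exact (tangentMapWithin_eq_tangentMap (e.open_target.uniqueMDiffOn _ hq.1)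
      ((hs.contMDiffAt (e.open_target.mem_nhds hq.1)).mdifferentiableAt (by simp))).symm
  exact hF.smooth.comp h1 fun q hq => tangentMap_symm_snd_ne_zero he hq.1 hq.2

end Finsler

end

theorem mainTheorem6 {n : ℕ} (hn : 3 ≤ n) {M : Type*} [TopologicalSpace M]
    [ChartedSpace (Finsler.E n) M] [IsManifold (𝓡 n) ∞ M]
    (F K : TangentBundle (𝓡 n) M → ℝ)
    (hF : Finsler.IsFinslerMetric F) (hK : Finsler.IsOfScalarFlagCurvature F K)
    (e : OpenPartialHomeomorph M (Finsler.E n))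
    (he : e ∈ IsManifold.maximalAtlas (𝓡 n) ∞ M)
    (f κ : Finsler.E n → Finsler.E n → ℝ)
    (hf : f = Finsler.inChart e F) (hκ : κ = Finsler.inChart e K)
    (x : Finsler.E n) (hx : x ∈ e.target) (y : Finsler.E n) (hy : y ≠ 0) (k : Fin n) :
    (f x y * Finsler.hderiv f k κ x y - Finsler.dy k f x y * Finsler.hderivZero f κ x y
        - (1 / 3) * f x y * Finsler.hderivCovectorZero f (fun j => Finsler.dy j κ) k x y = 0) ∧
      Finsler.dy k (fun x y => Finsler.hderivZero f κ x y / f x y) x y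
        = (4 / 3) * (Finsler.hderivCovectorZero f (fun j => Finsler.dy j κ) k x y / f x y) := by
  subst hf hκ
  have hU : IsOpen {q : Finsler.E n × Finsler.E n | q.1 ∈ e.target ∧ q.2 ≠ 0} :=
    (e.open_target.preimage continuous_fst).inter (isOpen_ne.preimage continuous_snd)
  have hs := Finsler.contDiffOn_inChart he hF
  let Fa : Finsler.smoothOn {q : Finsler.E n × Finsler.E n | q.1 ∈ e.target ∧ q.2 ≠ 0} :=
    ⟨fun q => Finsler.inChart e F q.1.1 q.1.2, _, hs, fun _ => rfl⟩
  refine Finsler.scalar_flag_curvature_eq hU (Fa := Fa) (fun _ => rfl)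
    (fun q => hF.posDef e he _ q.2.1 _ q.2.2) hn (fun q => q.2.2) (fun q h0 => ?_) (fun q => ?_)
    (fun q u hu => hK e he _ q.2.1 _ _ hu) (x := x) (y := y) ⟨hx, hy⟩ k
  · exact Finsler.tangentMap_symm_snd_ne_zero he q.2.1 q.2.2 ((hF.eq_zero_iff _).1 h0)
  · refine Finsler.euler_of_homogeneous ?_ fun c hc => Finsler.inChart_smul hF e _ _ hc
    have hd : DifferentiableAt ℝ
        (fun q : Finsler.E n × Finsler.E n => Finsler.inChart e F q.1 q.2) (q.1.1, q.1.2) :=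
      (hs.contDiffAt (hU.mem_nhds q.2)).differentiableAt (by simp)
    exact hd.comp q.1.2 (f := fun y' => (q.1.1, y')) (by fun_prop)
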